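/- Let $K\subseteq\mathbb{R}^n$ be non-empty, closed and convex, and let $f:K\to\mathbb{R}^n$ be $C^1$ with $(f(z)-f(w))^T(z-w)\le 0$ for all $z,w\in K$. For $z\in K$ let $N_K(z)=\{v: v^T(w-z)\le 0 \text{ for all } w\in K\}$ be the normal cone, and let $\mathbf{P}_C$ denote the Euclidean projection onto a non-empty closed convex set $C$. Let $\phi:[0,\infty)\times K\to K$ be a semi-flow (continuous, $\phi(0,z)=z$, $\phi(t+s,z)=\phi(t,\phi(s,z))$) whose trajectories $z(t)=\phi(t,z(0))$ are Carathéodory solutions of $$\dot z=f(z)-\mathbf{P}_{N_K(z)}(f(z)),$$ i.e. $z$ is absolutely continuous on compact time intervals and satisfies the equation for almost every $t\ge 0$. Assume that $\phi$ has an equilibrium point, i.e. a point $\bar z\in K$ with $\phi(t,\bar z)=\bar z$ for all $t\ge0$. Let $\Omega=\bigcup_{x\in K}\bigcap_{t\ge 0}\overline{\{\phi(s,x):s\ge t\}}$ be the $\omega$-limit set. A face of $K$ is a convex subset $F\subseteq K$ that contains every line segment of $K$ whose relative interior meets $F$. Let $F$ be the minimal face of $K$ containing all equilibrium points (the intersection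 of all faces containing them), let $V$ be the affine span of $F$, and let $N_V$ be the normal cone of $V$ (the same at each point of $V$). Then: 1. $\Omega\subseteq F$. 2. The vector field $z\mapsto f(z)-\mathbf{P}_{N_V}(f(z))$ is $C^1$ on $K$. 3. The restriction of $\phi$ to $\Omega$ extends to a flow of isometries: there is a flow $\psi:\mathbb{R}\times\Omega\to\Omega$ with $\psi(t,z)=\phi(t,z)$ for all $t\ge 0$, $z\in\Omega$, and $|\psi(t,z)-\psi(t,w)|=|z-w|$ for all $t\in\mathbb{R}$, $z,w\in\Omega$. Moreover each of its trajectories $z(t)=\psi(t,z(0))$ is differentiable and satisfies, for every $t\in\mathbb{R}$, $$\dot z=f(z)-\mathbf{P}_{N_V}(f(z)).$$ -/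

import Mathlib

open Set Filter Topology MeasureTheory
open scoped NNReal RealInnerProductSpace

noncomputable section

section ConvexGeometry

variable {E : Type*} [NormedAddCommGroup E] [InnerProductSpace ℝ E]

/-- The normal cone `N_K(z)` to `K` through `z`. -/
def normalCone (K : Set E) (z : E) : Set E :=
  {v | ∀ w ∈ K, ⟪v, w - z⟫ ≤ 0}

/-- The normal cone `N_V` of an affine subspace, i.e. the common value of `normalCone V z` for
`z ∈ V`; see `normalCone_coe_eq_affineNormalCone`. -/
def affineNormalCone (V : AffineSubspace ℝ E) : Set E :=
  {v | ∀ z ∈ V, v ∈ normalCone (V : Set E) z}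

theorem normalCone_coe_eq_affineNormalCone (V : AffineSubspace ℝ E) {z : E} (hz : z ∈ V) :
    normalCone (V : Set E) z = affineNormalCone V := by
  ext v
  refine ⟨fun h y hy w hw => ?_, fun h => h z hz⟩
  have h1 : (w - y) + z ∈ V :=
    AffineSubspace.vadd_mem_of_mem_direction (AffineSubspace.vsub_mem_direction hw hy) hz
  simpa using h _ h1

/-- The projection `P_C(x)` of `x` onto `C`: a point of `C` nearest to `x`. For `C` non-empty,
closed and convex in a complete space it exists and is unique (`projOnto_spec`, `projOnto_unique`);
where there is no nearest point the value is `0`. -/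
def projOnto (C : Set E) (x : E) : E :=
  open Classical in
  if h : ∃ p ∈ C, ∀ q ∈ C, ‖x - p‖ ≤ ‖x - q‖ then h.choose else 0

theorem projOnto_spec [CompleteSpace E] {C : Set E} (hne : C.Nonempty) (hcl : IsClosed C)
    (hco : Convex ℝ C) (x : E) :
    projOnto C x ∈ C ∧ ∀ q ∈ C, ‖x - projOnto C x‖ ≤ ‖x - q‖ := by
  have h : ∃ p ∈ C, ∀ q ∈ C, ‖x - p‖ ≤ ‖x - q‖ := by
    obtain ⟨p, hp, hpe⟩ := exists_norm_eq_iInf_of_complete_convex hne hcl.isComplete hco x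
    refine ⟨p, hp, fun q hq => ?_⟩
    rw [hpe]
    exact ciInf_le ⟨0, by rintro _ ⟨y, rfl⟩; exact norm_nonneg _⟩ (⟨q, hq⟩ : C)
  rw [projOnto, dif_pos h]
  exact h.choose_spec

theorem projOnto_unique [CompleteSpace E] {C : Set E} (hcl : IsClosed C) (hco : Convex ℝ C)
    {x p : E} (hp : p ∈ C) (hmin : ∀ q ∈ C, ‖x - p‖ ≤ ‖x - q‖) : projOnto C x = p := by
  have key : ∀ r ∈ C, (∀ q ∈ C, ‖x - r‖ ≤ ‖x - q‖) → ∀ w ∈ C, ⟪x - r, w - r⟫ ≤ 0 := by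
    intro r hr hr'
    refine (norm_eq_iInf_iff_real_inner_le_zero hco hr).1 (le_antisymm ?_ ?_)
    · have : Nonempty C := ⟨⟨r, hr⟩⟩
      exact le_ciInf fun w => hr' w w.2
    · exact ciInf_le ⟨0, by rintro _ ⟨y, rfl⟩; exact norm_nonneg _⟩ (⟨r, hr⟩ : C)
  obtain ⟨h1, h2⟩ := projOnto_spec ⟨p, hp⟩ hcl hco x
  have e1 := key _ h1 h2 p hp
  have e2 := key _ hp hmin _ h1
  have e3 : ⟪p - projOnto C x, p - projOnto C x⟫ ≤ 0 := by
    have : ⟪p - projOnto C x, p - projOnto C x⟫ =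
        ⟪x - projOnto C x, p - projOnto C x⟫ + ⟪x - p, projOnto C x - p⟫ := by
      rw [← neg_sub p (projOnto C x), inner_neg_right, ← sub_eq_add_neg, ← inner_sub_left]
      congr 1
      abel
    linarith
  exact (sub_eq_zero.1 ((inner_self_eq_zero (𝕜 := ℝ)).1 (le_antisymm e3 real_inner_self_nonneg))).symm

/-- A face of `K`: a convex subset that contains every segment of `K` whose relative interior it
meets. -/
def IsFace (K F : Set E) : Prop :=
  IsExtreme ℝ K F ∧ Convex ℝ F

/-- The intersection of all faces of `K` that contain `A`. -/
def minimalFace (K A : Set E) : Set E :=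
  ⋂₀ {F | IsFace K F ∧ A ⊆ F}

theorem isLeast_minimalFace {K A : Set E} (hK : Convex ℝ K) (hA : A ⊆ K) :
    IsLeast {F | IsFace K F ∧ A ⊆ F} (minimalFace K A) := by
  refine ⟨⟨⟨isExtreme_sInter ⟨K, ⟨IsExtreme.refl ℝ K, hK⟩, hA⟩ fun F hF => hF.1.1,
    convex_sInter fun F hF => hF.1.2⟩, subset_sInter fun F hF => hF.2⟩,
    fun F hF => sInter_subset_of_mem hF⟩

end ConvexGeometry

section Dynamics

/-- The set of `ω`-limit points of all trajectories of a semi-flow. -/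
def omegaLimitSet {X : Type*} [TopologicalSpace X] (φ : Flow ℝ≥0 X) : Set X :=
  ⋃ x, omegaLimit atTop φ {x}

/-- The equilibrium points of a semi-flow. -/
def equilibria {X : Type*} [TopologicalSpace X] (φ : Flow ℝ≥0 X) : Set X :=
  {x | ∀ t, φ t x = x}

variable {E : Type*} [NormedAddCommGroup E]

/-- `z : [0, ∞) → E` is a Carathéodory solution of `ż = g(z)`: it is absolutely continuous
(on every compact interval), and for almost all times its derivative exists and is `g (z t)`. -/
def IsCaratheodorySolution [NormedSpace ℝ E] (g : E → E) (z : ℝ≥0 → E) : Prop :=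
  (∀ T : ℝ, 0 < T → AbsolutelyContinuousOnInterval (fun t : ℝ => z t.toNNReal) 0 T) ∧
  ∀ᵐ t : ℝ, 0 < t → HasDerivAt (fun s : ℝ => z s.toNNReal) (g (z t.toNNReal)) t

end Dynamics

/-- The vector field `f(z) - P_{N_K(z)}(f(z))`. -/
def projectedField {E : Type*} [NormedAddCommGroup E] [InnerProductSpace ℝ E]
    (K : Set E) (f : E → E) (z : E) : E :=
  f z - projOnto (normalCone K z) (f z)

/-- The vector field `f(z) - P_{N_V}(f(z))` for an affine subspace `V`. -/
def affineProjectedField {E : Type*} [NormedAddCommGroup E] [InnerProductSpace ℝ E]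
    (V : AffineSubspace ℝ E) (f : E → E) (z : E) : E :=
  f z - projOnto (affineNormalCone V) (f z)

end

/-!
Monotonicity makes the semiflow nonexpansive. Every point of `Ω` is recurrent, and by compactness
so is every pair of them; as distances along trajectories only decrease, the semiflow is isometric
on `Ω`, and therefore extends to a flow there.

Isometries act affinely on segments, so `Ω` is convex and the flow is affine on it. The compact
convex hull of the `ω`-limit set of `z ∈ Ω` is invariant under the semiflow and hence contains an
equilibrium, which lies in the relative interior of a segment of `K` starting at `z`. A face
containing all equilibria thus contains `z`.

Finally, the distance of a trajectory in `Ω` to an equilibrium is constant, which forces the normal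
component of `f` along the trajectory to be orthogonal to the displacement from the equilibrium.
That component cuts out a face of `K` containing all equilibria, so it is orthogonal to the affine
span `V` of the minimal face. The velocity is parallel to `V`, since the trajectory stays in `V`.
Hence the normal component is the projection of `f` to the normal cone of `V`, and the equation has
a continuous right-hand side.
-/

section ClusterPoints

theorem mapClusterPt_atTop_iff_dist {ι X : Type*} [Preorder ι] [IsDirectedOrder ι] [Nonempty ι]
    [PseudoMetricSpace X] {u : ι → X} {x : X} :
    MapClusterPt x atTop u ↔ ∀ ε > 0, ∀ i, ∃ j ≥ i, dist (u j) x < ε := by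
  simp only [Metric.nhds_basis_ball.mapClusterPt_iff_frequently, frequently_atTop, Metric.mem_ball]

theorem le_of_antitone_of_mapClusterPt {ι α : Type*} [Preorder ι] [TopologicalSpace α] [Preorder α]
    [ClosedIicTopology α] {u : ι → α} {a : α} (hu : Antitone u) (ha : MapClusterPt a atTop u)
    (i : ι) : a ≤ u i :=
  isClosed_Iic.mem_of_mapClusterPt ha ((eventually_ge_atTop i).mono fun _ hij => hu hij)

theorem exists_lt_dist_lt_of_isCompact {X : Type*} [PseudoMetricSpace X] {s : Set X}
    (hs : IsCompact s) {u : ℕ → X} (hu : ∀ n, u n ∈ s) {ε : ℝ} (hε : 0 < ε) :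
    ∃ m n, m < n ∧ dist (u n) (u m) < ε := by
  obtain ⟨_, -, g, hg, hlim⟩ := hs.tendsto_subseq hu
  obtain ⟨N, hN⟩ := Metric.cauchySeq_iff'.1 hlim.cauchySeq ε hε
  exact ⟨g N, g (N + 1), hg N.lt_succ_self, hN (N + 1) N.le_succ⟩

end ClusterPoints

section TwoSidedExtension

variable {Y : Type*}

/-- The two-sided extension `φ_{t⁻}⁻¹ ∘ φ_{t⁺}`, `t ∈ ℝ`, of a semiflow of bijections. -/
noncomputable def twoSidedExtension [TopologicalSpace Y] (φ : Flow ℝ≥0 Y)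
    (hφ : ∀ t, Function.Bijective (φ t)) (t : ℝ) (y : Y) : Y :=
  (Equiv.ofBijective _ (hφ (-t).toNNReal)).symm (φ t.toNNReal y)

theorem coe_toNNReal_eq_coe_toNNReal_neg_add (r : ℝ) :
    (r.toNNReal : ℝ) = (-r).toNNReal + r :=
  sub_eq_iff_eq_add'.1 (max_zero_sub_max_neg_zero_eq_self r)

section Bijective

variable [TopologicalSpace Y] {φ : Flow ℝ≥0 Y} (hφ : ∀ t, Function.Bijective (φ t))

theorem flow_twoSidedExtension {a b : ℝ≥0} {t : ℝ} (hab : (b : ℝ) = a + t) (y : Y) :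
    φ a (twoSidedExtension φ hφ t y) = φ b y := by
  have hsum : a + t.toNNReal = (-t).toNNReal + b := by
    rw [← NNReal.coe_inj, NNReal.coe_add, NNReal.coe_add, hab,
      coe_toNNReal_eq_coe_toNNReal_neg_add t, add_left_comm]
  refine (hφ (-t).toNNReal).1 ?_
  rw [← Flow.map_add, add_comm, Flow.map_add, ← Flow.map_add (t₂ := b), ← hsum, Flow.map_add]
  exact congrArg (φ a) (Equiv.ofBijective_apply_symm_apply _ (hφ _) _)

theorem twoSidedExtension_eq {a b : ℝ≥0} {t : ℝ} (hab : (b : ℝ) = a + t) {y w : Y}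
    (h : φ b y = φ a w) : twoSidedExtension φ hφ t y = w :=
  (hφ a).1 ((flow_twoSidedExtension hφ hab y).trans h)

theorem twoSidedExtension_coe (t : ℝ≥0) (y : Y) : twoSidedExtension φ hφ t y = φ t y :=
  twoSidedExtension_eq hφ (a := 0) (b := t) (by simp) (φ.map_zero_apply _).symm

theorem twoSidedExtension_add (s t : ℝ) (y : Y) :
    twoSidedExtension φ hφ (s + t) y =
      twoSidedExtension φ hφ s (twoSidedExtension φ hφ t y) := by
  have hs := coe_toNNReal_eq_coe_toNNReal_neg_add s
  have ht := coe_toNNReal_eq_coe_toNNReal_neg_add t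
  refine twoSidedExtension_eq hφ (a := (-t).toNNReal + (-s).toNNReal)
    (b := s.toNNReal + t.toNNReal) (by push_cast; linarith) ?_
  rw [Flow.map_add _ (-t).toNNReal, flow_twoSidedExtension hφ hs, ← Flow.map_add,
    add_comm (-t).toNNReal, Flow.map_add, Flow.map_add, flow_twoSidedExtension hφ ht]

end Bijective

section Isometry

variable [EMetricSpace Y] {φ : Flow ℝ≥0 Y} (hφ : ∀ t, Function.Bijective (φ t))

theorem isometry_twoSidedExtension (hiso : ∀ t, Isometry (φ t)) (t : ℝ) :
    Isometry (twoSidedExtension φ hφ t) := fun y w => by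
  have ht := coe_toNNReal_eq_coe_toNNReal_neg_add t
  rw [← hiso (-t).toNNReal, flow_twoSidedExtension hφ ht, flow_twoSidedExtension hφ ht, hiso]

theorem continuous_twoSidedExtension (hiso : ∀ t, Isometry (φ t)) :
    Continuous (Function.uncurry (twoSidedExtension φ hφ)) := by
  refine continuous_iff_continuousAt.2 fun ⟨t, y⟩ => ?_
  obtain ⟨a, ha⟩ : ∃ a : ℝ≥0, 1 - t ≤ a := ⟨_, Real.le_coe_toNNReal _⟩
  have hcont : Continuous fun p : ℝ × Y => φ (a + p.1).toNNReal p.2 :=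
    φ.continuous (by fun_prop) continuous_snd
  have hnear : ∀ᶠ p : ℝ × Y in 𝓝 (t, y), t - 1 < p.1 :=
    continuous_fst.continuousAt.eventually (lt_mem_nhds (sub_one_lt t))
  refine (hiso a).isEmbedding.continuousAt_iff.2 (hcont.continuousAt.congr ?_)
  filter_upwards [hnear] with p hp
  exact (flow_twoSidedExtension hφ (Real.coe_toNNReal _ (by linarith)) p.2).symm

theorem exists_flow_real_extending_of_isometry (hiso : ∀ t, Isometry (φ t))
    (hsurj : ∀ t, Function.Surjective (φ t)) :
    ∃ ψ : Flow ℝ Y, (∀ (t : ℝ≥0) (y : Y), ψ t y = φ t y) ∧ ∀ t, Isometry (ψ t) :=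
  have hbij t : Function.Bijective (φ t) := ⟨(hiso t).injective, hsurj t⟩
  ⟨{ toFun := twoSidedExtension φ hbij
     cont' := continuous_twoSidedExtension hbij hiso
     map_add' := twoSidedExtension_add hbij
     map_zero' := fun y =>
      (twoSidedExtension_coe hbij 0 y).trans (φ.map_zero_apply y) },
    twoSidedExtension_coe hbij, isometry_twoSidedExtension hbij hiso⟩

end Isometry

end TwoSidedExtension

section NonexpansiveSemiflow

section TopologicalSpace

variable {X : Type*} [TopologicalSpace X] (φ : Flow ℝ≥0 X)

theorem isInvariant_omegaLimit_atTop (s : Set X) : IsInvariant φ (omegaLimit atTop φ s) :=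
  φ.isInvariant_omegaLimit atTop s fun _ => tendsto_atTop_mono (fun _ => le_add_self) tendsto_id

theorem isInvariant_omegaLimitSet : IsInvariant φ (omegaLimitSet φ) := fun t =>
  mapsTo_iUnion_iUnion fun x => isInvariant_omegaLimit_atTop φ {x} t

theorem omegaLimit_singleton_subset_omegaLimitSet (x : X) :
    omegaLimit atTop φ {x} ⊆ omegaLimitSet φ :=
  subset_iUnion (fun x => omegaLimit atTop φ {x}) x

theorem equilibria_subset_omegaLimitSet : equilibria φ ⊆ omegaLimitSet φ := fun x hx =>
  omegaLimit_singleton_subset_omegaLimitSet φ x <|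
    (mem_omegaLimit_singleton_iff_mapClusterPt _ _ _ _).2 <|
      (tendsto_const_nhds.congr fun t => (hx t).symm).mapClusterPt

end TopologicalSpace

theorem isCompact_omegaLimit_singleton {X : Type*} [PseudoMetricSpace X] [ProperSpace X]
    {φ : Flow ℝ≥0 X} {x : X} (hx : Bornology.IsBounded (range fun t => φ t x)) :
    IsCompact (omegaLimit atTop φ {x}) := by
  refine hx.isCompact_closure.of_isClosed_subset (isClosed_omegaLimit _ _ _) ?_
  simpa only [image2_singleton_right, image_univ] using
    omegaLimit_subset_closure_image2 (s := {x}) atTop φ univ_mem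

/-- Every time map of the semiflow `φ` is nonexpansive. -/
def IsNonexpansive {X : Type*} [PseudoMetricSpace X] (φ : Flow ℝ≥0 X) : Prop :=
  ∀ t, LipschitzWith 1 (φ t)

namespace IsNonexpansive

section PseudoMetricSpace

variable {X : Type*} [PseudoMetricSpace X] {φ : Flow ℝ≥0 X} (hφ : IsNonexpansive φ) {x y z w : X}
include hφ

theorem dist_flow_le (t : ℝ≥0) (x y : X) : dist (φ t x) (φ t y) ≤ dist x y := by
  simpa using (hφ t).dist_le_mul x y

theorem antitone_dist_flow (x y : X) : Antitone fun t => dist (φ t x) (φ t y) := by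
  intro s t hst
  obtain ⟨r, rfl⟩ := exists_add_of_le hst
  simpa only [add_comm s r, Flow.map_add] using hφ.dist_flow_le r (φ s x) (φ s y)

theorem isBounded_range_flow (he : (equilibria φ).Nonempty) (x : X) :
    Bornology.IsBounded (range fun t => φ t x) := by
  obtain ⟨e, he⟩ := he
  refine (Metric.isBounded_closedBall (x := e) (r := dist x e)).subset ?_
  rintro _ ⟨t, rfl⟩
  rw [Metric.mem_closedBall]
  simpa only [he t] using hφ.dist_flow_le t x e

theorem mem_omegaLimit_of_mem_omegaLimit (hy : y ∈ omegaLimit atTop φ {x})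
    (hz : z ∈ omegaLimit atTop φ {x}) : z ∈ omegaLimit atTop φ {y} := by
  rw [mem_omegaLimit_singleton_iff_mapClusterPt, mapClusterPt_atTop_iff_dist] at *
  intro ε hε T
  obtain ⟨s, -, hs⟩ := hy (ε / 2) (half_pos hε) 0
  obtain ⟨r, hr, hrz⟩ := hz (ε / 2) (half_pos hε) (T + s)
  rw [← tsub_add_cancel_of_le (le_add_self.trans hr), Flow.map_add] at hrz
  refine ⟨r - s, le_tsub_of_add_le_right hr, ?_⟩
  have hsy := hφ.dist_flow_le (r - s) y (φ s x)
  rw [dist_comm y] at hsy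
  linarith [dist_triangle (φ (r - s) y) (φ (r - s) (φ s x)) z]

theorem mem_omegaLimit_self (hz : z ∈ omegaLimitSet φ) : z ∈ omegaLimit atTop φ {z} := by
  obtain ⟨x, hx⟩ := mem_iUnion.1 hz
  exact hφ.mem_omegaLimit_of_mem_omegaLimit hx hx

theorem mapClusterPt_self (hz : z ∈ omegaLimitSet φ) : MapClusterPt z atTop fun t => φ t z :=
  (mem_omegaLimit_singleton_iff_mapClusterPt _ _ _ _).1 (hφ.mem_omegaLimit_self hz)

theorem dist_flow_add_flow (hz : z ∈ omegaLimitSet φ) (s t : ℝ≥0) :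
    dist (φ (s + t) z) (φ s z) = dist (φ t z) z := by
  have hanti : Antitone fun s => dist (φ t (φ s z)) (φ s z) := by
    simpa only [← Flow.map_add, add_comm t] using hφ.antitone_dist_flow (φ t z) z
  have hcluster : MapClusterPt (dist (φ t z) z) atTop fun s => dist (φ t (φ s z)) (φ s z) :=
    (hφ.mapClusterPt_self hz).continuousAt_comp
      ((φ.continuous_toFun t).dist continuous_id).continuousAt
  refine le_antisymm ?_ ?_
  · rw [Flow.map_add]
    exact hφ.dist_flow_le s _ _
  · rw [add_comm, Flow.map_add]
    exact le_of_antitone_of_mapClusterPt hanti hcluster s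

variable [ProperSpace X] (hb : ∀ x, Bornology.IsBounded (range fun t => φ t x))
include hb

/- Among the times `0, T, 2T, …` two give nearby values of both trajectories; since the distance
between two points of a recurrent trajectory depends only on the time lag, that lag is a common
almost-return time. -/
theorem mapClusterPt_prodMk_self (hz : z ∈ omegaLimitSet φ) (hw : w ∈ omegaLimitSet φ) :
    MapClusterPt (z, w) atTop fun t => (φ t z, φ t w) := by
  refine mapClusterPt_atTop_iff_dist.2 fun ε hε T => ?_
  obtain ⟨m, n, hmn, hdist⟩ := exists_lt_dist_lt_of_isCompact
    ((hb z).isCompact_closure.prod (hb w).isCompact_closure)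
    (u := fun n : ℕ => (φ (n * T) z, φ (n * T) w))
    (fun n => ⟨subset_closure ⟨_, rfl⟩, subset_closure ⟨_, rfl⟩⟩) hε
  obtain ⟨k, rfl⟩ := exists_add_of_le (Nat.succ_le_of_lt hmn)
  have hlag : ((m.succ + k : ℕ) : ℝ≥0) * T = m * T + (k + 1) * T := by push_cast; ring
  simp only [hlag, Prod.dist_eq, hφ.dist_flow_add_flow hz, hφ.dist_flow_add_flow hw] at hdist
  exact ⟨(k + 1) * T, le_mul_of_one_le_left' le_add_self, hdist⟩

theorem dist_flow_eq (hz : z ∈ omegaLimitSet φ) (hw : w ∈ omegaLimitSet φ) (t : ℝ≥0) :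
    dist (φ t z) (φ t w) = dist z w :=
  le_antisymm (hφ.dist_flow_le t z w) <|
    le_of_antitone_of_mapClusterPt (hφ.antitone_dist_flow z w)
      ((hφ.mapClusterPt_prodMk_self hb hz hw).continuousAt_comp continuous_dist.continuousAt) t

end PseudoMetricSpace

section MetricSpace

variable {X : Type*} [MetricSpace X] [ProperSpace X] {φ : Flow ℝ≥0 X} (hφ : IsNonexpansive φ)
  (hb : ∀ x, Bornology.IsBounded (range fun t => φ t x)) {z : X}
include hφ hb

/- A preimage of `z` under `φ t` is a limit of `φ (s - t) z` along times `s → ∞` for which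
`φ s z → z`. -/
theorem surjOn_omegaLimitSet (t : ℝ≥0) : SurjOn (φ t) (omegaLimitSet φ) (omegaLimitSet φ) := by
  intro z hz
  obtain ⟨U, hU, hUz⟩ := mapClusterPt_iff_ultrafilter.1 (hφ.mapClusterPt_self hz)
  obtain ⟨y, -, hy⟩ := (hb z).isCompact_closure.ultrafilter_le_nhds
    (U.map fun s : ℝ≥0 => φ (s - t) z)
    (tendsto_principal.2 (.of_forall fun s => subset_closure ⟨s - t, rfl⟩))
  have hsub : Tendsto (fun s : ℝ≥0 => s - t) U atTop := by
    refine Tendsto.mono_left (tendsto_atTop.2 fun b => ?_) hU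
    filter_upwards [eventually_ge_atTop (b + t)] with s hs using le_tsub_of_add_le_right hs
  have hyω : MapClusterPt y atTop fun s => φ s z :=
    MapClusterPt.of_comp hsub (Tendsto.mapClusterPt hy)
  refine ⟨y, omegaLimit_singleton_subset_omegaLimitSet φ z <|
      (mem_omegaLimit_singleton_iff_mapClusterPt _ _ _ _).2 hyω,
    tendsto_nhds_unique (((φ.continuous_toFun t).tendsto y).comp hy) (hUz.congr' ?_)⟩
  filter_upwards [hU (eventually_ge_atTop t)] with s hs
  simp only [Function.comp_apply]
  rw [← Flow.map_add, add_tsub_cancel_of_le hs]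

theorem exists_flow_omegaLimitSet :
    ∃ ψ : Flow ℝ (omegaLimitSet φ),
      (∀ (t : ℝ≥0) (z : omegaLimitSet φ), (ψ (t : ℝ) z : X) = φ t z) ∧ ∀ t, Isometry (ψ t) := by
  set φΩ := φ.restrict (isInvariant_omegaLimitSet φ)
  have hiso t : Isometry (φΩ t) := Isometry.of_dist_eq fun z w => hφ.dist_flow_eq hb z.2 w.2 t
  have hsurj t : Function.Surjective (φΩ t) := fun z => by
    obtain ⟨y, hy, hyz⟩ := hφ.surjOn_omegaLimitSet hb t z.2
    exact ⟨⟨y, hy⟩, Subtype.ext hyz⟩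
  obtain ⟨ψ, hψ, hψiso⟩ := exists_flow_real_extending_of_isometry hiso hsurj
  exact ⟨ψ, fun t z => congrArg Subtype.val (hψ t z), hψiso⟩

end MetricSpace

end IsNonexpansive

end NonexpansiveSemiflow

section ConvexHull

variable {E : Type*} [NormedAddCommGroup E] [NormedSpace ℝ E]

/- By Carathéodory's theorem the convex hull is a finite union of images of the compact sets
`stdSimplex × s ^ k`. -/
theorem isCompact_convexHull_of_isCompact [FiniteDimensional ℝ E] {s : Set E} (hs : IsCompact s) :
    IsCompact (convexHull ℝ s) := by
  let combination (k : ℕ) (p : (Fin k → ℝ) × (Fin k → E)) : E := ∑ i, p.1 i • p.2 i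
  suffices h : convexHull ℝ s = ⋃ k ∈ Finset.range (Module.finrank ℝ E + 2),
      combination k '' (stdSimplex ℝ (Fin k) ×ˢ univ.pi fun _ => s) by
    rw [h]
    exact (Finset.range _).isCompact_biUnion fun k _ =>
      ((isCompact_stdSimplex ℝ (Fin k)).prod (isCompact_univ_pi fun _ => hs)).image (by fun_prop)
  refine Subset.antisymm (fun x hx => ?_) (iUnion₂_subset fun k _ => ?_)
  · obtain ⟨ι, _, z, w, hz, hind, hw, hw1, rfl⟩ := eq_pos_convex_span_of_mem_convexHull hx
    have hcard : Fintype.card ι ≤ Module.finrank ℝ E + 1 :=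
      hind.card_le_finrank_succ.trans (Nat.succ_le_succ (Submodule.finrank_le _))
    let e := (Fintype.equivFin ι).symm
    refine mem_biUnion (Finset.mem_coe.2 (Finset.mem_range.2 (Nat.lt_succ_of_le hcard)))
      ⟨(w ∘ e, z ∘ e), ⟨⟨fun i => (hw _).le, ?_⟩, fun i _ => hz (mem_range_self _)⟩, ?_⟩
    · exact (e.sum_comp w).trans hw1
    · exact e.sum_comp fun i => w i • z i
  · rintro _ ⟨⟨w, z⟩, ⟨⟨hw, hw1⟩, hz⟩, rfl⟩
    exact (convex_convexHull ℝ s).sum_mem (fun i _ => hw i) hw1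
      fun i _ => subset_convexHull ℝ s (hz i (mem_univ i))

theorem exists_add_smul_sub_mem_convexHull {s : Set E} {c : E} (hc : c ∈ convexHull ℝ s) :
    ∃ y ∈ s, ∃ ε : ℝ, 0 < ε ∧ c + ε • (c - y) ∈ convexHull ℝ s := by
  classical
  obtain ⟨ι, _, z, w, hz, -, hw, hw1, rfl⟩ := eq_pos_convex_span_of_mem_convexHull hc
  obtain ⟨i₀, -⟩ : (Finset.univ : Finset ι).Nonempty :=
    Finset.nonempty_of_sum_ne_zero (hw1.trans_ne one_ne_zero)
  refine ⟨z i₀, hz (mem_range_self i₀), w i₀, hw i₀, ?_⟩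
  have hmem := (convex_convexHull ℝ s).sum_mem (t := Finset.univ) (z := z)
    (w := fun i => w i + w i₀ * (w i - if i = i₀ then 1 else 0)) (fun i _ => ?_) ?_
    fun i _ => subset_convexHull ℝ s (hz (mem_range_self i))
  · simpa only [add_smul, mul_smul, sub_smul, ite_smul, one_smul, zero_smul,
      Finset.sum_add_distrib, ← Finset.smul_sum, Finset.sum_sub_distrib, Finset.sum_ite_eq',
      Finset.mem_univ, if_true] using hmem
  · split_ifs with h
    · subst h
      nlinarith [hw i]
    · nlinarith [hw i, hw i₀]
  · simp only [Finset.sum_add_distrib, ← Finset.mul_sum, Finset.sum_sub_distrib, hw1,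
      Finset.sum_ite_eq', Finset.mem_univ, if_true, sub_self, mul_zero, add_zero]

theorem eq_lineMap_inv_one_add_iff {c y p : E} {ε : ℝ} (hε : 0 < ε) :
    c = AffineMap.lineMap y p (1 + ε)⁻¹ ↔ p = c + ε • (c - y) := by
  have h : p = (1 + ε) • (c - y) + y ↔ p = c + ε • (c - y) := by
    rw [show (1 + ε) • (c - y) + y = c + ε • (c - y) by module]
  rw [AffineMap.lineMap_apply_module', ← sub_eq_iff_eq_add,
    eq_inv_smul_iff₀ (by positivity), eq_comm, sub_eq_iff_eq_add, h]

theorem inv_one_add_mem_Ioo {ε : ℝ} (hε : 0 < ε) : (1 + ε)⁻¹ ∈ Ioo (0 : ℝ) 1 :=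
  ⟨by positivity, inv_lt_one_of_one_lt₀ (lt_add_of_pos_right 1 hε)⟩

theorem mem_of_isExtreme_of_add_smul_sub_mem {K F : Set E} (hF : IsExtreme ℝ K F) {c z : E}
    (hc : c ∈ F) (hz : z ∈ K) {ε : ℝ} (hε : 0 < ε) (h : c + ε • (c - z) ∈ K) : z ∈ F := by
  refine hF.left_mem_of_mem_openSegment hz h hc ?_
  have hmem := lineMap_mem_openSegment ℝ z (c + ε • (c - z)) (inv_one_add_mem_Ioo hε)
  rwa [← (eq_lineMap_inv_one_add_iff hε).2 rfl] at hmem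

end ConvexHull

section NonexpansiveSemiflowOnConvexSet

namespace IsNonexpansive

section StrictConvexSpace

variable {E : Type*} [NormedAddCommGroup E] [NormedSpace ℝ E] [StrictConvexSpace ℝ E]
  {K : Set E} [ProperSpace K] {φ : Flow ℝ≥0 K} (hφ : IsNonexpansive φ)
  (hb : ∀ x, Bornology.IsBounded (range fun t => φ t x))
include hφ hb

/- A nonexpansive map that preserves the distance of two points is affine on the segment joining
them, because in a strictly convex space the points of a segment are determined by their distances
to its endpoints. -/
theorem flow_eq_lineMap {z w m : K} (hz : z ∈ omegaLimitSet φ) (hw : w ∈ omegaLimitSet φ)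
    {r : ℝ} (hr : r ∈ Icc (0 : ℝ) 1) (hm : (m : E) = AffineMap.lineMap (z : E) (w : E) r)
    (t : ℝ≥0) : (φ t m : E) = AffineMap.lineMap (φ t z : E) (φ t w : E) r := by
  have hzm : dist z m = r * dist z w := by
    rw [Subtype.dist_eq, Subtype.dist_eq, hm, dist_left_lineMap, Real.norm_of_nonneg hr.1]
  have hmw : dist m w = (1 - r) * dist z w := by
    rw [Subtype.dist_eq, Subtype.dist_eq, hm, dist_lineMap_right,
      Real.norm_of_nonneg (sub_nonneg.2 hr.2)]
  have hzw := hφ.dist_flow_eq hb hz hw t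
  have htri := dist_triangle (φ t z) (φ t m) (φ t w)
  apply eq_lineMap_of_dist_eq_mul_of_dist_eq_mul <;> simp only [← Subtype.dist_eq, hzw] <;>
    linarith [hφ.dist_flow_le t z m, hφ.dist_flow_le t m w]

theorem convex_omegaLimitSet (hK : Convex ℝ K) :
    Convex ℝ (Subtype.val '' omegaLimitSet φ : Set E) := by
  rw [convex_iff_segment_subset]
  rintro _ ⟨z, hz, rfl⟩ _ ⟨w, hw, rfl⟩ x hx
  lift x to K using hK.segment_subset z.2 w.2 hx
  rw [segment_eq_image_lineMap] at hx
  obtain ⟨r, hr, hrx⟩ := hx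
  have hrec : MapClusterPt (x : E) atTop fun t => (φ t x : E) := by
    have hcont : Continuous fun p : K × K => AffineMap.lineMap (p.1 : E) (p.2 : E) r := by fun_prop
    simpa only [Function.comp_def, hrx, ← hφ.flow_eq_lineMap hb hz hw hr hrx.symm] using
      (hφ.mapClusterPt_prodMk_self hb hz hw).continuousAt_comp hcont.continuousAt
  exact ⟨x, omegaLimit_singleton_subset_omegaLimitSet φ x <|
    (mem_omegaLimit_singleton_iff_mapClusterPt _ _ _ _).2 <|
      IsInducing.subtypeVal.mapClusterPt_iff.1 hrec, rfl⟩

theorem convex_omegaLimitSet_inter_preimage (hK : Convex ℝ K) {C : Set E} (hC : Convex ℝ C)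
    (t : ℝ≥0) : Convex ℝ (Subtype.val '' {y ∈ omegaLimitSet φ | (φ t y : E) ∈ C}) := by
  rw [convex_iff_segment_subset]
  rintro _ ⟨z, ⟨hz, hzC⟩, rfl⟩ _ ⟨w, ⟨hw, hwC⟩, rfl⟩ x hx
  obtain ⟨m, hm, rfl⟩ :=
    (hφ.convex_omegaLimitSet hb hK).segment_subset ⟨z, hz, rfl⟩ ⟨w, hw, rfl⟩ hx
  rw [segment_eq_image_lineMap] at hx
  obtain ⟨r, hr, hrm⟩ := hx
  refine ⟨m, ⟨hm, ?_⟩, rfl⟩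
  rw [hφ.flow_eq_lineMap hb hz hw hr hrm.symm t]
  exact hC.lineMap_mem hzC hwC hr

theorem convexHull_omegaLimit_subset (hK : Convex ℝ K) (z : K) :
    convexHull ℝ (Subtype.val '' omegaLimit atTop φ {z}) ⊆ Subtype.val '' omegaLimitSet φ :=
  convexHull_min (image_mono (omegaLimit_singleton_subset_omegaLimitSet φ z))
    (hφ.convex_omegaLimitSet hb hK)

theorem flow_mem_convexHull_omegaLimit (hK : Convex ℝ K) (z : K) {x : K}
    (hx : (x : E) ∈ convexHull ℝ (Subtype.val '' omegaLimit atTop φ {z})) (t : ℝ≥0) :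
    (φ t x : E) ∈ convexHull ℝ (Subtype.val '' omegaLimit atTop φ {z}) := by
  set C := convexHull ℝ (Subtype.val '' omegaLimit atTop φ {z})
  have hsub : C ⊆ Subtype.val '' {y ∈ omegaLimitSet φ | (φ t y : E) ∈ C} := by
    refine convexHull_min (image_mono fun y hy => ?_)
      (hφ.convex_omegaLimitSet_inter_preimage hb hK (convex_convexHull ℝ _) t)
    exact ⟨omegaLimit_singleton_subset_omegaLimitSet φ z hy, subset_convexHull ℝ _
      (mem_image_of_mem _ (isInvariant_omegaLimit_atTop φ {z} t hy))⟩
  obtain ⟨y, ⟨-, hy⟩, hyx⟩ := hsub hx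
  rwa [Subtype.ext hyx] at hy

theorem flow_eq_add_smul_sub {c y p : K} (hc : c ∈ equilibria φ) (hy : y ∈ omegaLimitSet φ)
    (hp : p ∈ omegaLimitSet φ) {ε : ℝ} (hε : 0 < ε) (h : (p : E) = c + ε • ((c : E) - y))
    (t : ℝ≥0) : (φ t p : E) = c + ε • ((c : E) - φ t y) := by
  rw [← eq_lineMap_inv_one_add_iff hε] at h ⊢
  rw [← hφ.flow_eq_lineMap hb hy hp (Ioo_subset_Icc_self (inv_one_add_mem_Ioo hε)) h, hc]

theorem add_smul_sub_mem_of_mem_omegaLimit (hK : IsClosed K) {c y p w : K} (hc : c ∈ equilibria φ)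
    (hy : y ∈ omegaLimitSet φ) (hp : p ∈ omegaLimitSet φ) {ε : ℝ} (hε : 0 < ε)
    (h : (p : E) = c + ε • ((c : E) - y)) (hw : w ∈ omegaLimit atTop φ {y}) :
    (c : E) + ε • ((c : E) - w) ∈ K := by
  have hclosed : IsClosed {x : K | (c : E) + ε • ((c : E) - x) ∈ K} :=
    hK.preimage (f := fun x : K => (c : E) + ε • ((c : E) - x)) (by fun_prop)
  refine hclosed.mem_of_mapClusterPt ((mem_omegaLimit_singleton_iff_mapClusterPt _ _ _ _).1 hw)
    (.of_forall fun t => ?_)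
  rw [mem_ofPred_eq, ← hφ.flow_eq_add_smul_sub hb hc hy hp hε h t]
  exact (φ t p).2

end StrictConvexSpace

section InnerProductSpace

variable {E : Type*} [NormedAddCommGroup E] [InnerProductSpace ℝ E] {K : Set E} {φ : Flow ℝ≥0 K}
  (hφ : IsNonexpansive φ)
include hφ

/- The point of `C` nearest to an equilibrium is itself an equilibrium. -/
theorem exists_mem_equilibria_of_forall_flow_mem [CompleteSpace E]
    (he : (equilibria φ).Nonempty) {C : Set E} (hne : C.Nonempty) (hcl : IsClosed C)
    (hC : Convex ℝ C) (hCK : C ⊆ K) (hinv : ∀ (t : ℝ≥0) (x : K), (x : E) ∈ C → (φ t x : E) ∈ C) :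
    ∃ c ∈ equilibria φ, (c : E) ∈ C := by
  obtain ⟨e, he⟩ := he
  obtain ⟨hcC, hmin⟩ := projOnto_spec hne hcl hC (e : E)
  let c : K := ⟨projOnto C e, hCK hcC⟩
  refine ⟨c, fun t => Subtype.ext (projOnto_unique hcl hC (hinv t c hcC) fun q hq => ?_).symm, hcC⟩
  calc ‖(e : E) - φ t c‖ = dist (φ t e) (φ t c) := by rw [he t, Subtype.dist_eq, dist_eq_norm]
    _ ≤ dist e c := hφ.dist_flow_le t e c
    _ = ‖(e : E) - projOnto C e‖ := by rw [Subtype.dist_eq, dist_eq_norm]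
    _ ≤ ‖(e : E) - q‖ := hmin q hq

variable [FiniteDimensional ℝ E]

theorem exists_mem_equilibria_mem_convexHull (he : (equilibria φ).Nonempty) (hK : IsClosed K)
    (hKc : Convex ℝ K) {z : K} (hz : z ∈ omegaLimitSet φ) :
    ∃ c ∈ equilibria φ, (c : E) ∈ convexHull ℝ (Subtype.val '' omegaLimit atTop φ {z}) := by
  have := ProperSpace.of_isClosed hK
  have hb := hφ.isBounded_range_flow he
  have hne : (Subtype.val '' omegaLimit atTop φ {z} : Set E).Nonempty :=
    ⟨z, z, hφ.mem_omegaLimit_self hz, rfl⟩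
  have hcomp := isCompact_convexHull_of_isCompact
    ((isCompact_omegaLimit_singleton (hb z)).image continuous_subtype_val)
  have hsub : convexHull ℝ (Subtype.val '' omegaLimit atTop φ {z}) ⊆ K :=
    convexHull_min (image_subset_iff.2 fun x _ => x.2) hKc
  exact hφ.exists_mem_equilibria_of_forall_flow_mem he hne.convexHull hcomp.isClosed
    (convex_convexHull ℝ _) hsub fun t _ hx => hφ.flow_mem_convexHull_omegaLimit hb hKc z hx t

/- An equilibrium in the convex hull of `ω(z)` lies strictly between some `y ∈ ω(z)` and another
`ω`-limit point `p`. The flow is affine on the line through `y` and `p`, so the same equilibrium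
lies strictly between `z ∈ ω(y)` and a point of `K`. -/
theorem omegaLimitSet_subset_of_isExtreme (he : (equilibria φ).Nonempty) (hK : IsClosed K)
    (hKc : Convex ℝ K) {F : Set E} (hF : IsExtreme ℝ K F)
    (heF : Subtype.val '' equilibria φ ⊆ F) : Subtype.val '' omegaLimitSet φ ⊆ F := by
  have := ProperSpace.of_isClosed hK
  have hb := hφ.isBounded_range_flow he
  rintro _ ⟨z, hz, rfl⟩
  obtain ⟨c, hc, hcz⟩ := hφ.exists_mem_equilibria_mem_convexHull he hK hKc hz
  obtain ⟨_, ⟨y, hy, rfl⟩, ε, hε, hp⟩ := exists_add_smul_sub_mem_convexHull hcz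
  obtain ⟨p, hpΩ, hpe⟩ := hφ.convexHull_omegaLimit_subset hb hKc z hp
  refine mem_of_isExtreme_of_add_smul_sub_mem hF (heF ⟨c, hc, rfl⟩) z.2 hε ?_
  exact hφ.add_smul_sub_mem_of_mem_omegaLimit hb hK hc
    (omegaLimit_singleton_subset_omegaLimitSet φ z hy) hpΩ hε hpe
    (hφ.mem_omegaLimit_of_mem_omegaLimit hy (hφ.mem_omegaLimit_self hz))

theorem omegaLimitSet_subset_minimalFace (he : (equilibria φ).Nonempty) (hK : IsClosed K)
    (hKc : Convex ℝ K) :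
    Subtype.val '' omegaLimitSet φ ⊆ minimalFace K (Subtype.val '' equilibria φ) :=
  subset_sInter fun _ hF => hφ.omegaLimitSet_subset_of_isExtreme he hK hKc hF.1.1 hF.2

end InnerProductSpace

end IsNonexpansive

end NonexpansiveSemiflowOnConvexSet

section Derivatives

theorem absolutelyContinuousOnInterval_comp_of_lipschitzWith {X Y : Type*} [PseudoMetricSpace X]
    [PseudoMetricSpace Y] {C : ℝ≥0} {g : X → Y} (hg : LipschitzWith C g) {f : ℝ → X} {a b : ℝ}
    (hf : AbsolutelyContinuousOnInterval f a b) :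
    AbsolutelyContinuousOnInterval (fun t => g (f t)) a b := by
  refine squeeze_zero (fun t => Finset.sum_nonneg fun i _ => dist_nonneg) (fun t => ?_)
    (by simpa using! Tendsto.const_mul (C : ℝ) hf)
  rw [Finset.mul_sum]
  exact Finset.sum_le_sum fun i _ => hg.dist_le_mul _ _

theorem le_of_ae_hasDerivAt_nonpos {g g' : ℝ → ℝ} {a b : ℝ} (hab : a ≤ b)
    (hg : AbsolutelyContinuousOnInterval g a b)
    (hd : ∀ᵐ t, t ∈ Ioc a b → HasDerivAt g (g' t) t ∧ g' t ≤ 0) : g b ≤ g a := by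
  rw [← sub_nonpos, ← hg.integral_deriv_eq_sub, intervalIntegral.integral_of_le hab]
  refine setIntegral_nonpos_of_ae_restrict ?_
  rw [EventuallyLE, ae_restrict_iff' measurableSet_Ioc]
  filter_upwards [hd] with t ht htm
  exact (ht htm).1.deriv.trans_le (ht htm).2

section NormedSpace

variable {E : Type*} [NormedAddCommGroup E] [NormedSpace ℝ E]

theorem hasDerivAt_of_ae_hasDerivAt_of_continuous [CompleteSpace E] {u h : ℝ → E} {a b : ℝ}
    (hh : Continuous h) (hu : AbsolutelyContinuousOnInterval u a b)
    (hd : ∀ᵐ t, t ∈ Ioo a b → HasDerivAt u (h t) t) {t : ℝ} (ht : t ∈ Ioo a b) :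
    HasDerivAt u (h t) t := by
  let G (s : ℝ) : E := ∫ r in a..s, h r
  have hG (s : ℝ) : HasDerivAt G (h s) s := hh.integral_hasStrictDerivAt a s |>.hasDerivAt
  have hderiv : deriv G = h := funext fun s => (hG s).deriv
  have hGac : AbsolutelyContinuousOnInterval G a b :=
    (contDiff_one_iff_deriv.2 ⟨fun s => (hG s).differentiableAt,
      hderiv ▸ hh⟩).contDiffOn.absolutelyContinuousOnInterval
  have hab : a ≤ b := (ht.1.trans ht.2).le
  obtain ⟨C, hC⟩ := (hu.sub hGac).const_of_ae_hasDerivAt_zero (by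
    rw [uIcc_of_le hab]
    filter_upwards [hd, Ioo_ae_eq_Icc.mem_iff] with s hs hmem hsIcc
    simpa only [sub_self] using (hs (hmem.2 hsIcc)).sub (hG s))
  refine ((hG t).add_const C).congr_of_eventuallyEq ?_
  filter_upwards [Ioo_mem_nhds ht.1 ht.2] with s hs
  rw [← hC s (uIcc_of_le hab ▸ Ioo_subset_Icc_self hs), Pi.sub_apply, add_sub_cancel]

theorem mem_direction_of_hasDerivAt {V : AffineSubspace ℝ E} (hV : IsClosed (V.direction : Set E))
    {u : ℝ → E} {u' : E} {t : ℝ} (hd : HasDerivAt u u' t) (hu : ∀ s, u s ∈ V) :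
    u' ∈ V.direction :=
  hV.mem_of_tendsto (hasDerivAt_iff_tendsto_slope.1 hd) <| .of_forall fun s =>
    V.direction.smul_mem _ (V.vsub_mem_direction (hu s) (hu t))

theorem hasDerivAt_flow_of_forall_hasDerivAt {X : Type*} [TopologicalSpace X] (ψ : Flow ℝ X)
    {u g : X → E} {t₀ : ℝ} (h : ∀ x, HasDerivAt (fun s => u (ψ s x)) (g (ψ t₀ x)) t₀)
    (x : X) (t : ℝ) : HasDerivAt (fun s => u (ψ s x)) (g (ψ t x)) t := by
  have hd : HasDerivAt (fun s => u (ψ s (ψ (t - t₀) x))) (g (ψ t₀ (ψ (t - t₀) x)))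
      (t - (t - t₀)) := by
    rw [sub_sub_cancel]
    exact h _
  simpa only [← Flow.map_add, sub_add_cancel, add_sub_cancel] using
    hd.comp_sub_const t (t - t₀)

end NormedSpace

section InnerProductSpace

variable {E : Type*} [NormedAddCommGroup E] [InnerProductSpace ℝ E]

theorem norm_le_of_ae_hasDerivAt_inner_nonpos {u u' : ℝ → E} {a b : ℝ} (hab : a ≤ b)
    (hu : AbsolutelyContinuousOnInterval u a b)
    (hd : ∀ᵐ t, t ∈ Ioc a b → HasDerivAt u (u' t) t ∧ ⟪u t, u' t⟫ ≤ 0) : ‖u b‖ ≤ ‖u a‖ := by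
  have hnorm := absolutelyContinuousOnInterval_comp_of_lipschitzWith lipschitzWith_one_norm hu
  have hsq := le_of_ae_hasDerivAt_nonpos (g := fun t => ‖u t‖ * ‖u t‖)
    (g' := fun t => 2 * ⟪u t, u' t⟫) hab (hnorm.fun_mul hnorm) (by
      filter_upwards [hd] with t ht htm
      obtain ⟨hderiv, hle⟩ := ht htm
      exact ⟨by simpa only [← sq] using hderiv.norm_sq, by linarith⟩)
  exact (mul_self_le_mul_self_iff (norm_nonneg _) (norm_nonneg _)).2 hsq

theorem inner_eq_zero_of_hasDerivAt_of_norm_eq {u : ℝ → E} {u' : E} {t c : ℝ}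
    (hd : HasDerivAt u u' t) (hu : ∀ s, ‖u s‖ = c) : ⟪u t, u'⟫ = 0 := by
  have hsq := hd.norm_sq
  simp only [hu] at hsq
  simpa using hsq.unique (hasDerivAt_const t (c ^ 2))

end InnerProductSpace

end Derivatives

section NormalCone

variable {E : Type*} [NormedAddCommGroup E] [InnerProductSpace ℝ E]

theorem isClosed_normalCone (K : Set E) (z : E) : IsClosed (normalCone K z) := by
  simp only [normalCone, ofPred_forall]
  exact isClosed_biInter fun w _ => isClosed_le (by fun_prop) continuous_const

theorem convex_normalCone (K : Set E) (z : E) : Convex ℝ (normalCone K z) := by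
  intro u hu v hv a b ha hb _ w hw
  rw [inner_add_left, real_inner_smul_left, real_inner_smul_left]
  exact add_nonpos (mul_nonpos_of_nonneg_of_nonpos ha (hu w hw))
    (mul_nonpos_of_nonneg_of_nonpos hb (hv w hw))

theorem projOnto_normalCone_mem [CompleteSpace E] (K : Set E) (z x : E) :
    projOnto (normalCone K z) x ∈ normalCone K z :=
  (projOnto_spec ⟨0, fun w _ => by rw [inner_zero_left]⟩ (isClosed_normalCone K z)
    (convex_normalCone K z) x).1

theorem isFace_of_mem_normalCone {K : Set E} (hK : Convex ℝ K) {z v : E} (hz : z ∈ K)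
    (hv : v ∈ normalCone K z) : IsFace K {w ∈ K | ⟪v, w - z⟫ = 0} := by
  have hexposed : IsExposed ℝ K {w ∈ K | ⟪v, w - z⟫ = 0} := fun _ => by
    refine ⟨innerSL ℝ v, sep_ext_iff.2 fun w hw => ⟨fun h y hy => ?_, fun h => ?_⟩⟩
    · have := hv y hy
      rw [inner_sub_right] at h this
      simp only [innerSL_apply_apply]
      linarith
    · refine le_antisymm (hv w hw) ?_
      rw [inner_sub_right]
      exact sub_nonneg.2 (h z hz)
  exact ⟨hexposed.isExtreme, hexposed.convex hK⟩

theorem mem_orthogonal_direction_affineSpan {F : Set E} {v x : E}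
    (h : ∀ w ∈ F, ⟪v, w - x⟫ = 0) : v ∈ (affineSpan ℝ F).directionᗮ := by
  have hle : vectorSpan ℝ F ≤ (ℝ ∙ v)ᗮ := Submodule.span_le.2 <| by
    rintro _ ⟨a, ha, b, hb, rfl⟩
    change a - b ∈ (ℝ ∙ v)ᗮ
    rw [Submodule.mem_orthogonal_singleton_iff_inner_right, ← sub_sub_sub_cancel_right a b x,
      inner_sub_right, h a ha, h b hb, sub_zero]
  rw [direction_affineSpan, Submodule.mem_orthogonal']
  exact fun u hu => Submodule.mem_orthogonal_singleton_iff_inner_right.1 (hle hu)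

variable {V : AffineSubspace ℝ E}

theorem affineNormalCone_eq_orthogonal (hV : (V : Set E).Nonempty) :
    affineNormalCone V = (V.directionᗮ : Set E) := by
  obtain ⟨p, hp⟩ := hV
  ext v
  rw [← normalCone_coe_eq_affineNormalCone V hp, SetLike.mem_coe, Submodule.mem_orthogonal']
  refine ⟨fun h u hu => ?_, fun h w hw => (h _ (V.vsub_mem_direction hw hp)).le⟩
  have hpos := h _ (AffineSubspace.vadd_mem_of_mem_direction hu hp)
  have hneg := h _ (AffineSubspace.vadd_mem_of_mem_direction (V.direction.neg_mem hu) hp)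
  simp only [vadd_eq_add, add_sub_cancel_right, inner_neg_right] at hpos hneg
  linarith

variable [CompleteSpace E]

theorem projOnto_affineNormalCone_eq (hV : (V : Set E).Nonempty) {x v : E}
    (hv : v ∈ V.directionᗮ) (hxv : x - v ∈ V.direction) : projOnto (affineNormalCone V) x = v := by
  rw [affineNormalCone_eq_orthogonal hV]
  refine projOnto_unique V.direction.isClosed_orthogonal V.directionᗮ.convex hv fun q hq => ?_
  have horth : ⟪x - v, v - q⟫ = 0 :=
    Submodule.inner_right_of_mem_orthogonal hxv (V.directionᗮ.sub_mem hv hq)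
  have hpyth := norm_add_sq_eq_norm_sq_add_norm_sq_of_inner_eq_zero _ _ horth
  rw [sub_add_sub_cancel] at hpyth
  exact (mul_self_le_mul_self_iff (norm_nonneg _) (norm_nonneg _)).2
    (hpyth ▸ le_add_of_nonneg_right (mul_self_nonneg _))

theorem affineProjectedField_eq_starProjection [V.direction.HasOrthogonalProjection]
    (hV : (V : Set E).Nonempty) (f : E → E) (z : E) :
    affineProjectedField V f z = V.direction.starProjection (f z) := by
  rw [affineProjectedField, projOnto_affineNormalCone_eq hV
    (V.direction.sub_starProjection_mem_orthogonal (f z))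
    (by rw [sub_sub_cancel]; exact Submodule.starProjection_apply_mem _ _), sub_sub_cancel]

theorem contDiffOn_affineProjectedField [V.direction.HasOrthogonalProjection]
    (hV : (V : Set E).Nonempty) {m : WithTop ℕ∞} {f : E → E} {s : Set E}
    (hf : ContDiffOn ℝ m f s) : ContDiffOn ℝ m (affineProjectedField V f) s := by
  rw [funext (affineProjectedField_eq_starProjection hV f)]
  exact V.direction.starProjection.contDiff.comp_contDiffOn hf

end NormalCone

section ProjectedDynamics

variable {E : Type*} [NormedAddCommGroup E] [InnerProductSpace ℝ E] {K : Set E} {f : E → E}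

section ProjectedField

variable [CompleteSpace E]

theorem inner_projectedField_sub_le (hf : ∀ z ∈ K, ∀ w ∈ K, ⟪f z - f w, z - w⟫ ≤ 0) {z w : E}
    (hz : z ∈ K) (hw : w ∈ K) :
    ⟪z - w, projectedField K f z - projectedField K f w⟫ ≤
      ⟪projOnto (normalCone K z) (f z), w - z⟫ := by
  let u := projOnto (normalCone K z) (f z)
  let v := projOnto (normalCone K w) (f w)
  have hv : ⟪v, z - w⟫ ≤ 0 := projOnto_normalCone_mem K w (f w) z hz
  calc ⟪z - w, f z - u - (f w - v)⟫ = ⟪f z - f w, z - w⟫ + ⟪v, z - w⟫ + ⟪u, w - z⟫ := by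
        rw [← neg_sub z w, inner_neg_right, real_inner_comm, sub_sub_sub_comm, inner_sub_left,
          inner_sub_left u v]
        ring
    _ ≤ ⟪u, w - z⟫ := by linarith [hf z hz w hw]

theorem inner_projectedField_sub_nonpos (hf : ∀ z ∈ K, ∀ w ∈ K, ⟪f z - f w, z - w⟫ ≤ 0) {z w : E}
    (hz : z ∈ K) (hw : w ∈ K) : ⟪z - w, projectedField K f z - projectedField K f w⟫ ≤ 0 :=
  (inner_projectedField_sub_le hf hz hw).trans (projOnto_normalCone_mem K z (f z) w hw)

/- The normal component of `f z` is a supporting functional of `K` at `z`, so it cuts out a face of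
`K`. This face contains `A`, hence the minimal face. -/
theorem projectedField_eq_affineProjectedField (hK : Convex ℝ K) {A : Set E} (hA : A.Nonempty)
    (hAK : A ⊆ K) {z : E} (hz : z ∈ K)
    (hzA : ∀ a ∈ A, ⟪projOnto (normalCone K z) (f z), a - z⟫ = 0)
    (hdir : projectedField K f z ∈ (affineSpan ℝ (minimalFace K A)).direction) :
    projectedField K f z = affineProjectedField (affineSpan ℝ (minimalFace K A)) f z := by
  obtain ⟨⟨-, hAF⟩, hmin⟩ := isLeast_minimalFace hK hAK
  have hface := isFace_of_mem_normalCone hK hz (projOnto_normalCone_mem K z (f z))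
  have hsub : minimalFace K A ⊆ {w ∈ K | ⟪projOnto (normalCone K z) (f z), w - z⟫ = 0} :=
    hmin ⟨hface, fun a ha => ⟨hAK ha, hzA a ha⟩⟩
  have horth := mem_orthogonal_direction_affineSpan fun w hw => (hsub hw).2
  have hV := (affineSpan_nonempty ℝ).2 (hA.mono hAF)
  rw [affineProjectedField, projOnto_affineNormalCone_eq hV horth hdir, projectedField]

end ProjectedField

variable {φ : Flow ℝ≥0 K}

theorem isNonexpansive_of_isCaratheodorySolution [CompleteSpace E]
    (hf : ∀ z ∈ K, ∀ w ∈ K, ⟪f z - f w, z - w⟫ ≤ 0)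
    (hφ : ∀ z : K, IsCaratheodorySolution (projectedField K f) fun t => (φ t z : E)) :
    IsNonexpansive φ := by
  refine fun t => LipschitzWith.of_dist_le_mul fun z w => ?_
  rcases eq_or_ne t 0 with rfl | ht
  · simp
  replace ht : (0 : ℝ) < t := NNReal.coe_pos.2 (pos_iff_ne_zero.2 ht)
  have hle := norm_le_of_ae_hasDerivAt_inner_nonpos ht.le (((hφ z).1 t ht).sub ((hφ w).1 t ht))
    (u' := fun s => projectedField K f (φ s.toNNReal z) - projectedField K f (φ s.toNNReal w)) (by
      filter_upwards [(hφ z).2, (hφ w).2] with s hz hw hs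
      exact ⟨(hz hs.1).sub (hw hs.1), inner_projectedField_sub_nonpos hf (φ _ z).2 (φ _ w).2⟩)
  simpa [Subtype.dist_eq, dist_eq_norm] using hle

theorem projectedField_eq_zero_of_mem_equilibria
    (hφ : ∀ z : K, IsCaratheodorySolution (projectedField K f) fun t => (φ t z : E))
    {e : K} (he : e ∈ equilibria φ) : projectedField K f e = 0 := by
  have hderiv := (hφ e).2
  simp only [he _] at hderiv
  have hpos : (volume : Measure ℝ) (Ioi 0) ≠ 0 := by simp
  obtain ⟨t, ht, hd⟩ := ((frequently_ae_mem_iff.2 hpos).and_eventually hderiv).exists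
  exact (hd ht).unique (hasDerivAt_const t _)

variable [FiniteDimensional ℝ E]

/- The distance from an `ω`-limit trajectory to an equilibrium is constant, so equality holds in
`inner_projectedField_sub_le`. -/
theorem inner_projOnto_normalCone_sub_eq_zero (hK : IsClosed K)
    (hf : ∀ z ∈ K, ∀ w ∈ K, ⟪f z - f w, z - w⟫ ≤ 0)
    (hφ : ∀ z : K, IsCaratheodorySolution (projectedField K f) fun t => (φ t z : E))
    {z e : K} (hz : z ∈ omegaLimitSet φ) (he : e ∈ equilibria φ) {t : ℝ}
    (hd : HasDerivAt (fun s : ℝ => (φ s.toNNReal z : E)) (projectedField K f (φ t.toNNReal z)) t) :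
    ⟪projOnto (normalCone K (φ t.toNNReal z)) (f (φ t.toNNReal z)), (e : E) - φ t.toNNReal z⟫
      = 0 := by
  have := ProperSpace.of_isClosed hK
  have hne := isNonexpansive_of_isCaratheodorySolution hf hφ
  have hdist (s : ℝ) : ‖(φ s.toNNReal z : E) - e‖ = ‖(z : E) - e‖ := by
    simpa only [he s.toNNReal, Subtype.dist_eq, dist_eq_norm] using
      hne.dist_flow_eq (hne.isBounded_range_flow ⟨e, he⟩) hz
        (equilibria_subset_omegaLimitSet φ he) s.toNNReal
  have hle := inner_projectedField_sub_le hf (φ t.toNNReal z).2 e.2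
  rw [projectedField_eq_zero_of_mem_equilibria hφ he, sub_zero,
    inner_eq_zero_of_hasDerivAt_of_norm_eq (hd.sub_const (e : E)) hdist] at hle
  exact le_antisymm (projOnto_normalCone_mem K _ _ e e.2) hle

theorem hasDerivAt_flow_of_mem_omegaLimitSet (hK : IsClosed K) (hKc : Convex ℝ K)
    (hfc : ContinuousOn f K) (hf : ∀ z ∈ K, ∀ w ∈ K, ⟪f z - f w, z - w⟫ ≤ 0)
    (hφ : ∀ z : K, IsCaratheodorySolution (projectedField K f) fun t => (φ t z : E))
    (he : (equilibria φ).Nonempty) {z : K} (hz : z ∈ omegaLimitSet φ) {t : ℝ} (ht : 0 < t) :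
    HasDerivAt (fun s : ℝ => (φ s.toNNReal z : E))
      (affineProjectedField (affineSpan ℝ (minimalFace K (Subtype.val '' equilibria φ))) f
        (φ t.toNNReal z)) t := by
  let V := affineSpan ℝ (minimalFace K (Subtype.val '' equilibria φ))
  have heK : Subtype.val '' equilibria φ ⊆ K := Subtype.coe_image_subset K _
  have hV : (V : Set E).Nonempty :=
    (affineSpan_nonempty ℝ).2 ((he.image _).mono (isLeast_minimalFace hKc heK).1.2)
  have hzV (s : ℝ) : (φ s.toNNReal z : E) ∈ V :=
    subset_affineSpan ℝ _ <|
      (isNonexpansive_of_isCaratheodorySolution hf hφ).omegaLimitSet_subset_minimalFace he hK hKc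
        ⟨_, isInvariant_omegaLimitSet φ _ hz, rfl⟩
  have hcont : Continuous fun s : ℝ => affineProjectedField V f (φ s.toNNReal z) :=
    (contDiffOn_zero.1 (contDiffOn_affineProjectedField hV (contDiffOn_zero.2 hfc))).comp_continuous
      (continuous_subtype_val.comp (φ.continuous continuous_real_toNNReal continuous_const))
      fun s => (φ s.toNNReal z).2
  refine hasDerivAt_of_ae_hasDerivAt_of_continuous hcont ((hφ z).1 (t + 1) (by positivity)) ?_
    ⟨ht, lt_add_one t⟩
  filter_upwards [(hφ z).2] with s hs hs0
  have hd := hs hs0.1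
  rwa [projectedField_eq_affineProjectedField hKc (he.image _) heK (φ s.toNNReal z).2
    (forall_mem_image.2 fun e hee => inner_projOnto_normalCone_sub_eq_zero hK hf hφ hz hee hd)
    (mem_direction_of_hasDerivAt V.direction.closed_of_finiteDimensional hd hzV)] at hd

theorem hasDerivAt_of_flow_real_extending (hK : IsClosed K) (hKc : Convex ℝ K)
    (hfc : ContinuousOn f K) (hf : ∀ z ∈ K, ∀ w ∈ K, ⟪f z - f w, z - w⟫ ≤ 0)
    (hφ : ∀ z : K, IsCaratheodorySolution (projectedField K f) fun t => (φ t z : E))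
    (he : (equilibria φ).Nonempty) {ψ : Flow ℝ (omegaLimitSet φ)}
    (hψ : ∀ (t : ℝ≥0) (z : omegaLimitSet φ), (ψ (t : ℝ) z : K) = φ t z)
    (z : omegaLimitSet φ) (t : ℝ) :
    HasDerivAt (fun s : ℝ => ((ψ s z : K) : E))
      (affineProjectedField (affineSpan ℝ (minimalFace K (Subtype.val '' equilibria φ))) f
        (ψ t z : K)) t := by
  have hψ' (s : ℝ) (hs : 0 ≤ s) (w : omegaLimitSet φ) : (ψ s w : K) = φ s.toNNReal w := by
    rw [← hψ, Real.coe_toNNReal s hs]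
  refine hasDerivAt_flow_of_forall_hasDerivAt ψ (u := fun w => ((w : K) : E))
    (g := fun w => affineProjectedField _ f (w : K)) (t₀ := 1) (fun w => ?_) z t
  rw [hψ' 1 zero_le_one]
  refine HasDerivAt.congr_of_eventuallyEq
    (hasDerivAt_flow_of_mem_omegaLimitSet hK hKc hfc hf hφ he w.2 one_pos) ?_
  filter_upwards [Ioi_mem_nhds zero_lt_one] with s hs
  rw [hψ' s hs.le]

end ProjectedDynamics

theorem mainTheorem1_general {E : Type*} [NormedAddCommGroup E] [InnerProductSpace ℝ E]
    [FiniteDimensional ℝ E] {K : Set E} (hK_closed : IsClosed K) (hK_convex : Convex ℝ K)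
    {f : E → E} {m : WithTop ℕ∞} (hf : ContDiffOn ℝ m f K)
    (hf_mono : ∀ z ∈ K, ∀ w ∈ K, ⟪f z - f w, z - w⟫ ≤ 0) (φ : Flow ℝ≥0 K)
    (hφ : ∀ z : K, IsCaratheodorySolution (projectedField K f) fun t => (φ t z : E))
    (h_eq : (equilibria φ).Nonempty) :
    Subtype.val '' omegaLimitSet φ ⊆ minimalFace K (Subtype.val '' equilibria φ) ∧
    ContDiffOn ℝ m
      (affineProjectedField (affineSpan ℝ (minimalFace K (Subtype.val '' equilibria φ))) f) K ∧
    ∃ ψ : Flow ℝ (omegaLimitSet φ),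
      (∀ (t : ℝ≥0) (z : omegaLimitSet φ), (ψ (t : ℝ) z : K) = φ t z) ∧
      (∀ t : ℝ, Isometry (ψ t)) ∧
      ∀ (z : omegaLimitSet φ) (t : ℝ),
        HasDerivAt (fun s : ℝ => ((ψ s z : K) : E))
          (affineProjectedField (affineSpan ℝ (minimalFace K (Subtype.val '' equilibria φ))) f
            (ψ t z : K)) t := by
  have := ProperSpace.of_isClosed hK_closed
  have hne : IsNonexpansive φ := isNonexpansive_of_isCaratheodorySolution hf_mono hφ
  have hΩ := hne.omegaLimitSet_subset_minimalFace h_eq hK_closed hK_convex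
  have hV := (affineSpan_nonempty ℝ).2
    (((h_eq.mono (equilibria_subset_omegaLimitSet φ)).image _).mono hΩ)
  obtain ⟨ψ, hψ, hiso⟩ := hne.exists_flow_omegaLimitSet (hne.isBounded_range_flow h_eq)
  exact ⟨hΩ, contDiffOn_affineProjectedField hV hf, ψ, hψ, hiso,
    hasDerivAt_of_flow_real_extending hK_closed hK_convex hf.continuousOn hf_mono hφ h_eq hψ⟩

theorem mainTheorem1 (n : ℕ) (K : Set (EuclideanSpace ℝ (Fin n)))
    (hK_ne : K.Nonempty) (hK_closed : IsClosed K) (hK_convex : Convex ℝ K)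
    (f : EuclideanSpace ℝ (Fin n) → EuclideanSpace ℝ (Fin n))
    (hf : ContDiffOn ℝ 1 f K)
    (hf_mono : ∀ z ∈ K, ∀ w ∈ K, inner ℝ (f z - f w) (z - w) ≤ 0)
    (φ : Flow ℝ≥0 K)
    (hφ : ∀ z : K, IsCaratheodorySolution (projectedField K f)
      (fun t => (φ t z : EuclideanSpace ℝ (Fin n))))
    (h_eq : (equilibria φ).Nonempty) :
    Subtype.val '' omegaLimitSet φ ⊆ minimalFace K (Subtype.val '' equilibria φ) ∧
    ContDiffOn ℝ 1
      (affineProjectedField (affineSpan ℝ (minimalFace K (Subtype.val '' equilibria φ))) f) K ∧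
    ∃ ψ : Flow ℝ (omegaLimitSet φ),
      (∀ (t : ℝ≥0) (z : omegaLimitSet φ), (ψ (t : ℝ) z : K) = φ t z) ∧
      (∀ t : ℝ, Isometry (ψ t)) ∧
      ∀ (z : omegaLimitSet φ) (t : ℝ),
        HasDerivAt (fun s : ℝ => ((ψ s z : K) : EuclideanSpace ℝ (Fin n)))
          (affineProjectedField (affineSpan ℝ (minimalFace K (Subtype.val '' equilibria φ))) f
            ((ψ t z : K) : EuclideanSpace ℝ (Fin n))) t := by
  exact mainTheorem1_general hK_closed hK_convex hf hf_mono φ hφ h_eq
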